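/- Let $k$ be a field of characteristic zero, let $G$ be a commutative group, and let $\mathcal B=k[G]$ be its group algebra, with coproduct $\delta x=x\otimes x$ and counit $\varepsilon_{\mathcal B}(x)=1$ for $x\in G$. Let $T(\mathcal B)^+=\bigoplus_{n\ge1}T^n(\mathcal B)$, where $T^n(\mathcal B)=\mathcal B^{\otimes n}$ has generators $(x_1,\dots,x_n)=x_1\otimes\cdots\otimes x_n$, and let $S(T(\mathcal B)^+)$ be the symmetric algebra of the vector space $T(\mathcal B)^+$. Write $\delta a=\sum a_{(1)}\otimes a_{(2)}$ for the coproduct of $T(\mathcal B)$ that extends the coproduct of $\mathcal B$ multiplicatively. For $a=(x_1,\dots,x_n)$ and a composition $\rho=(r_1,\dots,r_\ell)$ of $n$, cut $a$ into consecutive blocks $a|\rho_1,\dots,a|\rho_\ell$ of lengths $r_1,\dots,r_\ell$, and put $a|\rho=(a|\rho_1)\cdots(a|\rho_\ell)\in S(T(\mathcal B)^+)$ and $a/\rho=(\prod a|\rho_1,\dots,\prod a|\rho_\ell)\in T^\ell(\mathcal B)$, where $\prod$ is the product in $\mathcal B$. Let $\Delta\colon S(T(\mathcal B)^+)\to S(T(\mathcal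 B)^+)\otimes S(T(\mathcal B)^+)$ and $\varepsilon\colon S(T(\mathcal B)^+)\to k$ be the algebra maps with $\Delta a=\sum_{\rho}a_{(1)}|\rho\otimes a_{(2)}/\rho$ for $a\in T^n(\mathcal B)$, $n\geq 1$, the sum being over all compositions $\rho$ of $n$, and with $\varepsilon((x))=\varepsilon_{\mathcal B}(x)$ and $\varepsilon((x_1,\dots,x_n))=0$ for $n>1$. Let $\{x_1,\dots,x_n\}=\sum_{\sigma\in\Sigma_n}(x_{\sigma(1)},\dots,x_{\sigma(n)})$, and let $S(S(\mathcal B)^+)$ be the subalgebra of $S(T(\mathcal B)^+)$ generated by the elements $\{x_1,\dots,x_n\}$ with $n\ge1$ and $x_i\in\mathcal B$. Let $\mathcal F=k[u_1,u_2,\dots]$, with the algebra maps determined by $\Delta u_n=\sum_{\pi\in\Pi_n}u_\pi\otimes u_{\ell(\pi)}$ and $\varepsilon(u_1)=1$, $\varepsilon(u_n)=0$ for $n>1$, where $\Pi_n$ is the set of partitions of $\{1,\dots,n\}$, $u_\pi=\prod_{C\in\pi}u_{|C|}$, and $\ell(\pi)$ is the number of blocks of $\pi$. Then $\mathcal F$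 is a bialgebra (the Faà di Bruno bialgebra), $\Delta$ and $\varepsilon$ restrict to a bialgebra structure on $S(S(\mathcal B)^+)$, and there is a unique algebra map $\varphi\colon S(S(\mathcal B)^+)\to\mathcal F$ such that $\varphi(1)=1$ and $\varphi(\{x_1,\dots,x_n\})=u_n$ for all $n\geq 1$ and $x_1,\dots,x_n\in G$. This $\varphi$ is a surjective homomorphism of bialgebras. -/

import Mathlib

open scoped TensorProduct DirectSum

noncomputable section

namespace Renormalization

/-! ### The double algebras `S(T(B)⁺)` and `S(S(B)⁺)` -/

section DoubleAlgebras

variable (k : Type*) [Field k] (B : Type*) [CommRing B] [Algebra k B]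

/-- `T(B)⁺ = ⨁_{n ≥ 1} T^n(B)`, the positive part of the tensor algebra of the vector space `B`. -/
abbrev TPlus : Type _ := ⨁ n : {n : ℕ // 0 < n}, ⨂[k]^n.1 B

/-- `S(T(B)⁺)`, the symmetric algebra of the vector space `T(B)⁺`, i.e. the quotient of the tensor
algebra `T(T(B)⁺)` by the ideal generated by all `ab - ba`, for `a, b ∈ T(B)⁺`. -/
abbrev SymT : Type _ := SymmetricAlgebra k (TPlus k B)

/-- The element `(x₁,…,xₙ) = x₁ ⊗ ⋯ ⊗ xₙ` of `T^n(B) ⊆ T(B)⁺`, for `n ≥ 1`, as a multilinear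
function of `x₁,…,xₙ`. -/
def word {n : ℕ} (hn : 0 < n) : MultilinearMap k (fun _ : Fin n => B) (TPlus k B) :=
  (DirectSum.lof k {n : ℕ // 0 < n} (fun m => ⨂[k]^m.1 B) ⟨n, hn⟩).compMultilinearMap
    (PiTensorProduct.tprod k (s := fun _ : Fin n => B))

/-- The symmetrizing operator `α : T(B)⁺ → T(B)⁺`,
`(x₁,…,xₙ) ↦ ∑_σ (x_{σ(1)},…,x_{σ(n)})`, the sum being over all permutations of `{1,…,n}`. -/
def symmetrize : TPlus k B →ₗ[k] TPlus k B :=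
  DirectSum.lmap fun n : {n : ℕ // 0 < n} =>
    ∑ σ : Equiv.Perm (Fin n.1), (PiTensorProduct.reindex k (fun _ => B) σ.symm).toLinearMap

/-- The algebra map `S(α) : S(T(B)⁺) → S(T(B)⁺)`, `a₁⋯a_r ↦ α(a₁)⋯α(a_r)`. -/
def symSymmetrize : SymT k B →ₐ[k] SymT k B :=
  SymmetricAlgebra.lift (SymmetricAlgebra.ι k (TPlus k B) ∘ₗ symmetrize k B)

/-- `S(S(B)⁺)`: the vector space `S(B)⁺` is identified with the image of `α` in `T(B)⁺`, and
`S(S(B)⁺)` with the image of `S(α)` in `S(T(B)⁺)`. -/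
def SymS : Subalgebra k (SymT k B) := (symSymmetrize k B).range

variable {B}

/-- The element `{x₁,…,xₙ} = ∑_σ (x_{σ(1)},…,x_{σ(n)})` of `S^n(B) ⊆ S(S(B)⁺)`, for `n ≥ 1`. -/
def brace {n : ℕ} (hn : 0 < n) (x : Fin n → B) : SymS k B :=
  ⟨symSymmetrize k B (SymmetricAlgebra.ι k (TPlus k B) (word k B hn x)), ⟨_, rfl⟩⟩

end DoubleAlgebras

/-! ### Restriction and contraction along a composition -/

section Compositions

variable {k : Type*} [Field k] {B : Type*} [CommRing B] [Algebra k B]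

/-- Given a composition `ρ` of `n`, multilinear maps `f i` on the blocks of `ρ` and a multilinear
map `g` in `ℓ(ρ)` variables, the multilinear map `x ↦ g (f₁ (x|ρ₁), …, f_ℓ (x|ρ_ℓ))`. -/
def blockwise {N M : Type*} [AddCommMonoid N] [Module k N] [AddCommMonoid M] [Module k M]
    {n : ℕ} (ρ : Composition n)
    (f : (i : Fin ρ.length) → MultilinearMap k (fun _ : Fin (ρ.blocksFun i) => B) N)
    (g : MultilinearMap k (fun _ : Fin ρ.length => N) M) :
    MultilinearMap k (fun _ : Fin n => B) M :=
  have key : ∀ (inst : DecidableEq (Fin n)) (x : Fin n → B) (j : Fin n) (v : B),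
      (fun i => f i (@Function.update _ _ inst x j v ∘ ρ.embedding i)) =
        Function.update (fun i => f i (x ∘ ρ.embedding i)) (ρ.index j)
          (f (ρ.index j)
            (Function.update (x ∘ ρ.embedding (ρ.index j)) (ρ.invEmbedding j) v)) := by
    intro inst x j v
    obtain rfl : inst = instDecidableEqFin n := Subsingleton.elim _ _
    funext i
    by_cases h : i = ρ.index j
    · subst h
      rw [Function.update_self]
      congr 1
      have h := Function.update_comp_eq_of_injective x (ρ.embedding (ρ.index j)).injective
        (ρ.invEmbedding j) v
      rwa [ρ.embedding_comp_inv j] at h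
    · rw [Function.update_of_ne h]
      congr 1
      refine Function.update_comp_eq_of_notMem_range x v ?_
      rwa [ρ.mem_range_embedding_iff']
  { toFun := fun x => g fun i => f i (x ∘ ρ.embedding i)
    map_update_add' := by
      intro inst x j v w
      simp only [key, MultilinearMap.map_update_add]
    map_update_smul' := by
      intro inst x j c v
      simp only [key, MultilinearMap.map_update_smul] }

variable (k B)

/-- The restriction map `a ↦ a|ρ = (a|ρ₁)⋯(a|ρ_ℓ)` from `T^n(B)` to `S(T(B)⁺)`. -/
def restrict {n : ℕ} (ρ : Composition n) : (⨂[k]^n B) →ₗ[k] SymT k B :=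
  PiTensorProduct.lift <| blockwise ρ
    (fun i => (SymmetricAlgebra.ι k (TPlus k B)).compMultilinearMap
      (word k B (ρ.one_le_blocksFun i)))
    (MultilinearMap.mkPiAlgebra k (Fin ρ.length) (SymT k B))

/-- The contraction map `a ↦ a/ρ = (∏ a|ρ₁, …, ∏ a|ρ_ℓ)` from `T^n(B)` to
`T^ℓ(B) ⊆ T(B)⁺ ⊆ S(T(B)⁺)`, the products being taken in `B`. -/
def contract {n : ℕ} (hn : 0 < n) (ρ : Composition n) : (⨂[k]^n B) →ₗ[k] SymT k B :=
  PiTensorProduct.lift <| blockwise ρ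
    (fun i => MultilinearMap.mkPiAlgebra k (Fin (ρ.blocksFun i)) B)
    ((SymmetricAlgebra.ι k (TPlus k B)).compMultilinearMap
      (word k B (ρ.length_pos_of_pos hn)))

/-- The projection of `T(B)` onto its homogeneous component `T^n(B)`. -/
def component (n : ℕ) : TensorAlgebra k B →ₗ[k] (⨂[k]^n B) :=
  DirectSum.component k ℕ (fun m => ⨂[k]^m B) n ∘ₗ TensorAlgebra.toDirectSum.toLinearMap

end Compositions

/-! ### The renormalization coproduct and counit -/

section Renormalization

variable (k : Type*) [Field k] (B : Type*) [CommRing B] [Bialgebra k B]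

/-- The free coproduct `δ : T(B) → T(B) ⊗ T(B)`, the algebra map extending the coproduct of `B`. -/
def freeComul : TensorAlgebra k B →ₐ[k] TensorAlgebra k B ⊗[k] TensorAlgebra k B :=
  TensorAlgebra.lift k
    (TensorProduct.map (TensorAlgebra.ι k) (TensorAlgebra.ι k) ∘ₗ Coalgebra.comul)

/-- The map `a ↦ ∑_{ρ ∈ C_n} a₍₁₎|ρ ⊗ a₍₂₎/ρ` on `T^n(B)`, where `δ a = ∑ a₍₁₎ ⊗ a₍₂₎`. -/
def renormComulWord {n : ℕ} (hn : 0 < n) : (⨂[k]^n B) →ₗ[k] SymT k B ⊗[k] SymT k B :=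
  (∑ ρ : Composition n,
    TensorProduct.map (restrict k B ρ ∘ₗ component k B n) (contract k B hn ρ ∘ₗ component k B n)) ∘ₗ
    (freeComul k B).toLinearMap ∘ₗ TensorPower.toTensorAlgebra

/-- The renormalization coproduct `Δ` on `S(T(B)⁺)`: the algebra map with
`Δ a = ∑_{ρ ∈ C_n} a₍₁₎|ρ ⊗ a₍₂₎/ρ` for `a ∈ T^n(B)`, `n ≥ 1`. -/
def renormComul : SymT k B →ₐ[k] SymT k B ⊗[k] SymT k B :=
  SymmetricAlgebra.lift (DirectSum.toModule k {n : ℕ // 0 < n} _ fun n => renormComulWord k B n.2)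

/-- The renormalization counit `ε` on `S(T(B)⁺)`: the algebra map with `ε((x)) = ε_B(x)` and
`ε((x₁,…,xₙ)) = 0` for `n > 1`. -/
def renormCounit : SymT k B →ₐ[k] k :=
  SymmetricAlgebra.lift (DirectSum.toModule k {n : ℕ // 0 < n} _ fun n =>
    if n.1 = 1 then
      PiTensorProduct.lift ((MultilinearMap.mkPiAlgebra k (Fin n.1) k).compLinearMap
        fun _ => (Coalgebra.counit : B →ₗ[k] k))
    else 0)

end Renormalization

/-! ### The Faà di Bruno bialgebra -/

section FaaDiBruno

variable (k : Type*) [Field k]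

/-- The algebra `k[u₁, u₂, …]` underlying the Faà di Bruno bialgebra. This is a type synonym, so
that Mathlib's bialgebra structure on `MvPolynomial` (with group-like monomials), which is a
different one, plays no role. -/
def FaaDiBruno : Type _ := MvPolynomial ℕ+ k

instance : CommRing (FaaDiBruno k) := inferInstanceAs (CommRing (MvPolynomial ℕ+ k))

instance : Algebra k (FaaDiBruno k) := inferInstanceAs (Algebra k (MvPolynomial ℕ+ k))

/-- The identification of the Faà di Bruno algebra with the polynomial algebra. -/
def FaaDiBruno.toMvPolynomial : FaaDiBruno k ≃ₐ[k] MvPolynomial ℕ+ k :=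
  AlgEquiv.refl (R := k) (A₁ := MvPolynomial ℕ+ k)

/-- The generator `u_n`, for `n ≥ 1` (only ever used for positive `n`). -/
def u (n : ℕ) : FaaDiBruno k := (FaaDiBruno.toMvPolynomial k).symm (MvPolynomial.X n.toPNat')

/-- The Faà di Bruno coproduct: the algebra map with `Δ u_n = ∑_{π ∈ Π_n} u_π ⊗ u_{ℓ(π)}`, where
`u_π = ∏_{C ∈ π} u_{|C|}` and `ℓ(π)` is the number of blocks of `π`. -/
def faaComul : FaaDiBruno k →ₐ[k] FaaDiBruno k ⊗[k] FaaDiBruno k :=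
  (MvPolynomial.aeval fun n : ℕ+ =>
    ∑ π : Finpartition (Finset.univ : Finset (Fin (n : ℕ))),
      (∏ C ∈ π.parts, u k C.card) ⊗ₜ[k] u k π.parts.card).comp
    (FaaDiBruno.toMvPolynomial k).toAlgHom

/-- The counit of the Faà di Bruno bialgebra: `ε(u₁) = 1` and `ε(u_n) = 0` for `n > 1`. -/
def faaCounit : FaaDiBruno k →ₐ[k] k :=
  (MvPolynomial.aeval fun n : ℕ+ => if n = 1 then (1 : k) else 0).comp
    (FaaDiBruno.toMvPolynomial k).toAlgHom

end FaaDiBruno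

/-- The axioms making an algebra map `Δ : A → A ⊗ A` and an algebra map `ε : A → k` into the
coproduct and the counit of a bialgebra: coassociativity and the two counit laws. -/
structure IsBialgebraStructure {k : Type*} [Field k] {A : Type*} [CommRing A] [Algebra k A]
    (Δ : A →ₐ[k] A ⊗[k] A) (ε : A →ₐ[k] k) : Prop where
  coassoc : (Algebra.TensorProduct.assoc k k k A A A).toAlgHom.comp
    ((Algebra.TensorProduct.map Δ (.id k A)).comp Δ) =
      (Algebra.TensorProduct.map (.id k A) Δ).comp Δ
  rTensor_counit : (Algebra.TensorProduct.map ε (.id k A)).comp Δ =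
    (Algebra.TensorProduct.lid k A).symm
  lTensor_counit : (Algebra.TensorProduct.map (.id k A) ε).comp Δ =
    (Algebra.TensorProduct.rid k k A).symm

/-- The bialgebra with given coproduct and counit. -/
abbrev IsBialgebraStructure.toBialgebra {k : Type*} [Field k] {A : Type*} [CommRing A]
    [Algebra k A] {Δ : A →ₐ[k] A ⊗[k] A} {ε : A →ₐ[k] k} (h : IsBialgebraStructure Δ ε) :
    Bialgebra k A :=
  Bialgebra.ofAlgHom Δ ε h.coassoc h.rTensor_counit h.lTensor_counit

end Renormalization

end

open Renormalization

open scoped TensorProduct DirectSum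

noncomputable section

namespace Renormalization

/-! ### Segmentations of lists -/

section Lists

variable {α β : Type*}

/-! The elements of `G` form a basis of `k[G]` consisting of group-like elements, and algebra maps
out of `S(T(B)⁺)` or `S(S(B)⁺)` are determined by words or braces in such a basis. On a word `l` of
group-like elements, `δ` merely doubles the word, so `Δ l` is a sum over the ways `L` of cutting `l`
into nonempty segments: the product of the words in `L`, tensored with the word of their products
(`renormComul_listWord`). Coassociativity is then the bijection of `sum_segmentations_assoc`, and in
each counit law a single segmentation survives.

For braces, sum over all orderings of a finite set `s`. Cutting an ordering amounts to choosing a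
partition `π` of `s`, an ordering of its blocks, and an ordering of each block
(`sum_orderings_segmentations`). As `B` is commutative, the sums over orderings reassemble into
braces, and `Δ{s} = ∑_π (∏_{C ∈ π} {C}) ⊗ {∏ C : C ∈ π}` (`renormComul_setBrace`). Hence `Δ`
preserves `S(S(B)⁺)`, and replacing each brace of size `n` by `u_n` yields the Faà di Bruno
coproduct.

In characteristic zero `φ` is well defined because it is the restriction of a map on all of
`S(T(B)⁺)` that sends a word of `n` group-like elements to `u_n / n!`. The bialgebra axioms are
checked only on `S(T(B)⁺)`: they descend to `S(S(B)⁺)` along the injective inclusion, and pass from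
there to `𝓕` along the surjective `φ`. -/

theorem map_splitWrtCompositionAux (f : α → β) (ns : List ℕ) (l : List α) :
    (l.map f).splitWrtCompositionAux ns = (l.splitWrtCompositionAux ns).map (List.map f) := by
  induction ns generalizing l with
  | nil => rfl
  | cons n ns ih => simp [List.splitWrtCompositionAux_cons, ← List.map_take, ← List.map_drop, ih]

theorem map_splitWrtComposition (f : α → β) {n : ℕ} (c : Composition n) (l : List α) :
    (l.map f).splitWrtComposition c = (l.splitWrtComposition c).map (List.map f) :=
  map_splitWrtCompositionAux f _ l

theorem splitWrtComposition_injective (l : List α) :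
    Function.Injective fun c : Composition l.length => l.splitWrtComposition c := by
  intro c c' h
  have := congrArg (List.map List.length) h
  simp only [List.map_length_splitWrtComposition] at this
  exact Composition.ext this

/-- The finite set of all ways to cut a list into consecutive nonempty lists. -/
def segmentations (l : List α) : Finset (List (List α)) :=
  Finset.univ.map ⟨_, splitWrtComposition_injective l⟩

/-- This description involves no compositions, so iterated cuttings can be compared without
dependent indices. -/
theorem mem_segmentations {l : List α} {L : List (List α)} :
    L ∈ segmentations l ↔ L.flatten = l ∧ ∀ s ∈ L, s ≠ [] := by
  simp only [segmentations, Finset.mem_map, Finset.mem_univ, true_and, Function.Embedding.coeFn_mk]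
  constructor
  · rintro ⟨c, rfl⟩
    exact ⟨l.flatten_splitWrtComposition c, fun s hs =>
      List.length_pos_iff.1 (List.length_pos_of_mem_splitWrtComposition hs)⟩
  · rintro ⟨rfl, h⟩
    refine ⟨⟨L.map List.length, ?_, ?_⟩, List.splitWrtComposition_flatten _ _ rfl⟩
    · intro i hi
      obtain ⟨s, hs, rfl⟩ := List.mem_map.1 hi
      exact List.length_pos_iff.2 (h s hs)
    · rw [List.length_flatten]

theorem ne_nil_of_mem_segmentations {l : List α} (hl : l ≠ []) {L : List (List α)}
    (hL : L ∈ segmentations l) : L ≠ [] := by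
  rintro rfl
  exact hl (mem_segmentations.1 hL).1.symm

theorem sum_composition_eq_sum_segmentations {N : Type*} [AddCommMonoid N] {n : ℕ} (l : List α)
    (hl : l.length = n) (F : List (List α) → N) :
    ∑ c : Composition n, F (l.splitWrtComposition c) = ∑ L ∈ segmentations l, F L := by
  subst hl
  simp [segmentations]

theorem sum_segmentations_map {N : Type*} [AddCommMonoid N] (f : α → β) (l : List α)
    (F : List (List β) → N) :
    ∑ L ∈ segmentations (l.map f), F L = ∑ L ∈ segmentations l, F (L.map (List.map f)) := by
  rw [← sum_composition_eq_sum_segmentations (l.map f) (List.length_map f),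
    ← sum_composition_eq_sum_segmentations l rfl fun L => F (L.map (List.map f))]
  simp only [map_splitWrtComposition]

/-- Links list splitting to the block embeddings in terms of which `restrict` and `contract` are
defined. -/
theorem splitWrtComposition_ofFn {n : ℕ} (x : Fin n → α) (c : Composition n) :
    (List.ofFn x).splitWrtComposition c =
      List.ofFn fun i => List.ofFn fun j => x (c.embedding i j) := by
  apply List.ext_getElem
  · simp
  · intro i h₁ h₂
    have hi : i < c.length := by simpa using h₂
    rw [List.getElem_splitWrtComposition, List.getElem_ofFn]
    apply List.ext_getElem
    · have h := c.sizeUpTo_succ hi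
      have h' : c.sizeUpTo (i + 1) ≤ n := c.sizeUpTo_le _
      simp only [List.length_drop, List.length_take, List.length_ofFn, Composition.blocksFun,
        List.get_eq_getElem]
      omega
    · intro j h₃ h₄
      simp only [List.getElem_drop, List.getElem_take, List.getElem_ofFn]
      congr 1

/-- The finite set of all lists obtained from a list by choosing for each entry `a` an element of
`t a`. -/
def listChoices (t : α → Finset β) : List α → Finset (List β)
  | [] => {[]}
  | a :: l => (t a ×ˢ listChoices t l).map
      ⟨fun p => p.1 :: p.2, fun _ _ h => Prod.ext (List.cons.inj h).1 (List.cons.inj h).2⟩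

theorem mem_listChoices {t : α → Finset β} {l : List α} {N : List β} :
    N ∈ listChoices t l ↔ List.Forall₂ (fun b a => b ∈ t a) N l := by
  induction l generalizing N with
  | nil => simp [listChoices]
  | cons a l ih =>
    simp only [listChoices, Finset.mem_map, Finset.mem_product, Prod.exists,
      List.forall₂_cons_right_iff, ih]
    constructor
    · rintro ⟨b, N, h, rfl⟩
      exact ⟨b, N, h.1, h.2, rfl⟩
    · rintro ⟨b, N, h₁, h₂, rfl⟩
      exact ⟨b, N, ⟨h₁, h₂⟩, rfl⟩

theorem prod_map_sum_eq_sum_listChoices {A : Type*} [Semiring A] (t : α → Finset β) (f : β → A)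
    (l : List α) :
    (l.map fun a => ∑ b ∈ t a, f b).prod = ∑ N ∈ listChoices t l, (N.map f).prod := by
  induction l with
  | nil => simp [listChoices]
  | cons a l ih =>
    rw [listChoices, Finset.sum_map, Finset.sum_product, List.map_cons, List.prod_cons, ih,
      Finset.sum_mul_sum]
    exact Finset.sum_congr rfl fun _ _ => Finset.sum_congr rfl fun _ _ => List.prod_cons.symm

theorem mem_listChoices_segmentations {L : List (List α)} {K : List (List (List α))} :
    K ∈ listChoices segmentations L ↔
      K.map List.flatten = L ∧ ∀ M ∈ K, ∀ s ∈ M, s ≠ [] := by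
  rw [mem_listChoices]
  induction L generalizing K with
  | nil => constructor <;> aesop
  | cons l L ih =>
    cases K with
    | nil => simp
    | cons M K =>
      rw [List.forall₂_cons, mem_segmentations, ih]
      simp only [List.map_cons, List.cons.injEq, List.mem_cons, forall_eq_or_imp]
      tauto

/-- Cutting a list, then each of its parts, amounts to cutting the list and then the list of its
parts. -/
theorem sum_segmentations_assoc {N : Type*} [AddCommMonoid N] (l : List α)
    (F : List (List (List α)) → N) :
    ∑ L ∈ segmentations l, ∑ K ∈ listChoices segmentations L, F K =
      ∑ L ∈ segmentations l, ∑ K ∈ segmentations L, F K := by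
  rw [Finset.sum_sigma', Finset.sum_sigma']
  -- Both sides run over the same nested lists `K`, and `L` is redundant: it is `K.map List.flatten`
  -- on the left and `K.flatten` on the right.
  refine Finset.sum_bij' (fun p _ => ⟨p.2.flatten, p.2⟩) (fun p _ => ⟨p.2.map List.flatten, p.2⟩)
    ?_ ?_ ?_ ?_ ?_
  · rintro ⟨L, K⟩ h
    simp only [Finset.mem_sigma, mem_listChoices_segmentations, mem_segmentations] at h ⊢
    obtain ⟨⟨rfl, h₁⟩, rfl, h₂⟩ := h
    refine ⟨⟨?_, ?_⟩, trivial, ?_⟩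
    · rw [List.flatten_flatten]
    · intro s hs
      obtain ⟨M, hM, hs⟩ := List.mem_flatten.1 hs
      exact h₂ M hM s hs
    · rintro M hM rfl
      exact h₁ _ (List.mem_map_of_mem hM) rfl
  · rintro ⟨L, K⟩ h
    simp only [Finset.mem_sigma, mem_listChoices_segmentations, mem_segmentations] at h ⊢
    obtain ⟨⟨rfl, h₁⟩, rfl, h₂⟩ := h
    refine ⟨⟨?_, ?_⟩, trivial, ?_⟩
    · rw [List.flatten_flatten]
    · intro s hs
      obtain ⟨M, hM, rfl⟩ := List.mem_map.1 hs
      obtain ⟨s, M, rfl⟩ := List.exists_cons_of_ne_nil (h₂ M hM)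
      have := h₁ s (List.mem_flatten_of_mem hM List.mem_cons_self)
      simp [this]
    · exact fun M hM s hs => h₁ s (List.mem_flatten_of_mem hM hs)
  · rintro ⟨L, K⟩ h
    simp only [Finset.mem_sigma, mem_listChoices_segmentations] at h
    simp [h.2.1]
  · rintro ⟨L, K⟩ h
    simp only [Finset.mem_sigma, mem_segmentations] at h
    simp [h.2.1]
  · simp

end Lists

/-! ### Orderings of finite sets -/

section Orderings

variable {α : Type*}

/-- The finite set of all lists that enumerate a given finite set without repetition. -/
def orderings (s : Finset α) : Finset (List α) := ⟨s.val.lists, Multiset.lists_nodup_finset s⟩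

theorem mem_orderings {s : Finset α} {l : List α} : l ∈ orderings s ↔ (l : Multiset α) = s.val :=
  (Multiset.mem_lists_iff _ _).trans eq_comm

/-- Replaces permutations of positions by orderings of a set, so that braces can be indexed by
arbitrary finite sets, such as the blocks of a partition. -/
theorem sum_perm_eq_sum_orderings {N : Type*} [AddCommMonoid N] {m : ℕ} {s : Finset α}
    (e : Fin m ≃ s) (F : List α → N) :
    ∑ σ : Equiv.Perm (Fin m), F (List.ofFn fun i => (e (σ i) : α)) = ∑ l ∈ orderings s, F l := by
  refine Finset.sum_nbij (fun σ => List.ofFn fun i => (e (σ i) : α)) ?_ ?_ ?_ fun _ _ => rfl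
  · intro σ _
    refine mem_orderings.2 ((Multiset.Nodup.ext (Multiset.coe_nodup.2 ?_) s.nodup).2 ?_)
    · exact List.nodup_ofFn.2 (Subtype.val_injective.comp (e.injective.comp σ.injective))
    · intro a
      simp only [Multiset.mem_coe, List.mem_ofFn, Finset.mem_val]
      constructor
      · rintro ⟨i, rfl⟩
        exact (e (σ i)).2
      · exact fun ha => ⟨σ.symm (e.symm ⟨a, ha⟩), by simp⟩
  · intro σ _ τ _ h
    ext i
    have := congrFun (List.ofFn_injective h) i
    simpa [Fin.ext_iff] using this
  · intro l hl
    have hl := mem_orderings.1 hl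
    have hm : l.length = m := by
      have h₁ := congrArg Multiset.card hl
      have h₂ := Fintype.card_congr e
      simp only [Multiset.coe_card, Finset.card_val, Fintype.card_fin, Fintype.card_coe] at h₁ h₂
      omega
    subst hm
    have hs : ∀ i, l.get i ∈ s := fun i => by
      rw [← Finset.mem_val, ← hl]
      exact List.get_mem l i
    have hn : l.Nodup := Multiset.coe_nodup.1 (hl ▸ s.nodup)
    have hb : Function.Bijective fun i => e.symm ⟨l.get i, hs i⟩ :=
      Finite.injective_iff_bijective.1 fun i j h =>
        List.nodup_iff_injective_get.1 hn (congrArg Subtype.val (e.symm.injective h))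
    exact ⟨Equiv.ofBijective _ hb, Finset.mem_coe.2 (Finset.mem_univ _), by simp⟩

theorem mem_listChoices_orderings [DecidableEq α] {P : List (Finset α)} {L : List (List α)} :
    L ∈ listChoices orderings P ↔ L.map List.toFinset = P ∧ ∀ l ∈ L, l.Nodup := by
  rw [mem_listChoices]
  induction P generalizing L with
  | nil => constructor <;> aesop
  | cons s P ih =>
    cases L with
    | nil => simp
    | cons l L =>
      rw [List.forall₂_cons, mem_orderings, ih]
      have : (l : Multiset α) = s.val ↔ l.toFinset = s ∧ l.Nodup := by
        constructor
        · intro h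
          have hn : l.Nodup := Multiset.coe_nodup.1 (h ▸ s.nodup)
          refine ⟨Finset.val_injective ?_, hn⟩
          rw [← h, List.toFinset_val, hn.dedup]
        · rintro ⟨rfl, h⟩
          rw [List.toFinset_val, h.dedup]
      rw [this]
      simp only [List.map_cons, List.cons.injEq, List.mem_cons, forall_eq_or_imp]
      tauto

theorem mem_orderings_iff {s : Finset α} {l : List α} :
    l ∈ orderings s ↔ l.Nodup ∧ ∀ a, a ∈ l ↔ a ∈ s := by
  rw [mem_orderings]
  constructor
  · intro h
    refine ⟨Multiset.coe_nodup.1 (h ▸ s.nodup), fun a => ?_⟩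
    rw [← Finset.mem_val, ← h, Multiset.mem_coe]
  · exact fun h => (Multiset.Nodup.ext (Multiset.coe_nodup.2 h.1) s.nodup).2 h.2

/-- To cut an ordering of a finite set into segments is to choose a partition of the set, an
ordering of its blocks, and an ordering of each block. -/
theorem sum_orderings_segmentations [DecidableEq α] {N : Type*} [AddCommMonoid N] (s : Finset α)
    (F : List (List α) → N) :
    ∑ l ∈ orderings s, ∑ L ∈ segmentations l, F L =
      ∑ π : Finpartition s, ∑ P ∈ orderings π.parts, ∑ L ∈ listChoices orderings P, F L := by
  simp only [Finset.sum_sigma']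
  symm
  -- Nothing is lost by forgetting `π` and `P`: `P` lists the underlying sets of the segments in
  -- `L`, and `π` is the set of entries of `P`.
  refine Finset.sum_bij (fun p _ => ⟨p.2.2.flatten, p.2.2⟩) ?_ ?_ ?_ ?_
  · rintro ⟨π, P, L⟩ h
    simp only [Finset.mem_sigma, Finset.mem_univ, true_and, mem_listChoices_orderings,
      mem_orderings_iff, mem_segmentations] at h ⊢
    obtain ⟨⟨hP, hmem⟩, rfl, hL⟩ := h
    have hparts : ∀ l ∈ L, l.toFinset ∈ π.parts := fun l hl =>
      (hmem _).1 (List.mem_map_of_mem hl)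
    refine ⟨⟨List.nodup_flatten.2 ⟨hL, ?_⟩, fun a => ?_⟩, fun l hl => ?_⟩
    · refine (List.pairwise_map.1 hP).imp_of_mem fun {l₁ l₂} h₁ h₂ hne => ?_
      exact List.disjoint_toFinset_iff_disjoint.1
        (π.disjoint (hparts _ h₁) (hparts _ h₂) hne)
    · rw [List.mem_flatten]
      constructor
      · rintro ⟨l, hl, ha⟩
        exact π.le (hparts l hl) (List.mem_toFinset.2 ha)
      · intro ha
        obtain ⟨t, ht, hat⟩ := π.exists_mem ha
        obtain ⟨l, hl, rfl⟩ := List.mem_map.1 ((hmem t).2 ht)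
        exact ⟨l, hl, List.mem_toFinset.1 hat⟩
    · rintro rfl
      exact π.bot_notMem (hparts _ hl)
  · rintro ⟨π, P, L⟩ h ⟨π', P', L'⟩ h' heq
    simp only [Finset.mem_sigma, Finset.mem_univ, true_and, mem_listChoices_orderings,
      mem_orderings_iff] at h h'
    obtain ⟨⟨-, hmem⟩, rfl, -⟩ := h
    obtain ⟨⟨-, hmem'⟩, rfl, -⟩ := h'
    obtain rfl : L = L' := by simpa using congrArg Sigma.snd heq
    obtain rfl : π = π' := Finpartition.ext (Finset.ext fun t => by rw [← hmem, hmem'])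
    rfl
  · rintro ⟨l, L⟩ h
    simp only [Finset.mem_sigma, mem_orderings_iff, mem_segmentations] at h
    obtain ⟨⟨hn, hmem⟩, rfl, hne⟩ := h
    rw [List.nodup_flatten] at hn
    have hpw : (L.map List.toFinset).Pairwise Disjoint :=
      List.pairwise_map.2 (hn.2.imp fun h => List.disjoint_toFinset_iff_disjoint.2 h)
    -- A repeated block would be disjoint from itself, hence empty.
    have hnd : (L.map List.toFinset).Nodup := by
      refine hpw.imp_of_mem fun {t₁ t₂} h₁ _ hd => ?_
      rintro rfl
      obtain ⟨l, hl, rfl⟩ := List.mem_map.1 h₁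
      exact hne l hl ((List.toFinset_eq_empty_iff _).1 (disjoint_self.1 hd))
    let π : Finpartition s :=
      { parts := (L.map List.toFinset).toFinset
        supIndep := by
          rw [Finset.supIndep_iff_pairwiseDisjoint]
          intro t₁ h₁ t₂ h₂ hne
          exact hpw.forall (List.mem_toFinset.1 h₁)
            (List.mem_toFinset.1 h₂) hne
        sup_parts := by
          ext a
          simp only [Finset.mem_sup, List.mem_toFinset, List.mem_map, id_eq, ← hmem,
            List.mem_flatten]
          constructor
          · rintro ⟨_, ⟨l, hl, rfl⟩, ha⟩
            exact ⟨l, hl, List.mem_toFinset.1 ha⟩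
          · rintro ⟨l, hl, ha⟩
            exact ⟨_, ⟨l, hl, rfl⟩, List.mem_toFinset.2 ha⟩
        bot_notMem := by
          intro h
          obtain ⟨l, hl, h⟩ := List.mem_map.1 (List.mem_toFinset.1 h)
          exact hne l hl ((List.toFinset_eq_empty_iff _).1 h) }
    refine ⟨⟨π, L.map List.toFinset, L⟩, ?_, rfl⟩
    simp only [Finset.mem_sigma, Finset.mem_univ, true_and, mem_listChoices_orderings,
      mem_orderings_iff]
    exact ⟨⟨hnd, fun t => List.mem_toFinset.symm⟩, hn.1⟩
  · intros
    rfl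

end Orderings

/-! ### Words indexed by lists -/

section Words

variable (k : Type*) [Field k] {B : Type*} [CommRing B] [Algebra k B]

theorem word_congr {m n : ℕ} (hm : 0 < m) (hn : 0 < n) (h : m = n) {x : Fin m → B} {y : Fin n → B}
    (hxy : ∀ i, x i = y (Fin.cast h i)) : word k B hm x = word k B hn y := by
  subst h
  exact congrArg _ (funext hxy)

/-- The element `(x₁,…,xₙ)` of `S(T(B)⁺)` attached to the list `x₁,…,xₙ`, with the convention that
it vanishes for the empty list. -/
def listWord (l : List B) : SymT k B :=
  if h : 0 < l.length then SymmetricAlgebra.ι k (TPlus k B) (word k B h l.get) else 0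

theorem listWord_ofFn {n : ℕ} (hn : 0 < n) (x : Fin n → B) :
    listWord k (List.ofFn x) = SymmetricAlgebra.ι k (TPlus k B) (word k B hn x) := by
  have h : 0 < (List.ofFn x).length := by simpa using hn
  rw [listWord, dif_pos h]
  exact congrArg _ (word_congr k h hn List.length_ofFn fun i => by simp; rfl)

theorem restrict_tprod {n : ℕ} (ρ : Composition n) (x : Fin n → B) :
    restrict k B ρ (PiTensorProduct.tprod k x) =
      (((List.ofFn x).splitWrtComposition ρ).map (listWord k)).prod := by
  rw [restrict, PiTensorProduct.lift.tprod, splitWrtComposition_ofFn, List.map_ofFn,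
    List.prod_ofFn]
  change ∏ i, SymmetricAlgebra.ι k (TPlus k B) (word k B (ρ.one_le_blocksFun i) fun j =>
    x (ρ.embedding i j)) = _
  exact Finset.prod_congr rfl fun i _ =>
    (listWord_ofFn k (ρ.one_le_blocksFun i) fun j => x (ρ.embedding i j)).symm

theorem contract_tprod {n : ℕ} (hn : 0 < n) (ρ : Composition n) (x : Fin n → B) :
    contract k B hn ρ (PiTensorProduct.tprod k x) =
      listWord k (((List.ofFn x).splitWrtComposition ρ).map List.prod) := by
  rw [contract, PiTensorProduct.lift.tprod, splitWrtComposition_ofFn, List.map_ofFn,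
    listWord_ofFn k (ρ.length_pos_of_pos hn)]
  change SymmetricAlgebra.ι k (TPlus k B) (word k B _ fun i => ∏ j, x (ρ.embedding i j)) = _
  refine congrArg _ (congrArg _ (funext fun i => ?_))
  exact List.prod_ofFn.symm

theorem component_tprod {n : ℕ} (x : Fin n → B) :
    component k B n (TensorAlgebra.tprod k B n x) = PiTensorProduct.tprod k x := by
  rw [component, LinearMap.comp_apply, AlgHom.toLinearMap_apply,
    TensorAlgebra.toDirectSum_tensorPower_tprod]
  exact DirectSum.component.lof_self k (M := fun i => ⨂[k]^i B) n _

theorem symSymmetrize_word {n : ℕ} (hn : 0 < n) (x : Fin n → B) :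
    symSymmetrize k B (SymmetricAlgebra.ι k (TPlus k B) (word k B hn x)) =
      ∑ σ : Equiv.Perm (Fin n), listWord k (List.ofFn fun i => x (σ i)) := by
  have h : symmetrize k B (word k B hn x) =
      ∑ σ : Equiv.Perm (Fin n), word k B hn fun i => x (σ i) := by
    rw [symmetrize, word, LinearMap.compMultilinearMap_apply, DirectSum.lmap_lof,
      LinearMap.sum_apply, map_sum]
    simp
  rw [symSymmetrize, SymmetricAlgebra.lift_ι_apply, LinearMap.comp_apply, h, map_sum]
  exact Finset.sum_congr rfl fun σ _ => (listWord_ofFn k hn _).symm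

theorem coe_brace {n : ℕ} (hn : 0 < n) (x : Fin n → B) :
    (brace k hn x : SymT k B) = ∑ σ : Equiv.Perm (Fin n), listWord k (List.ofFn fun i => x (σ i)) :=
  symSymmetrize_word k hn x

/-- Linear maps on `T(B)⁺` are determined by their values on words in a basis of `B`. -/
theorem tPlus_linearMap_ext {ι N : Type*} [AddCommMonoid N] [Module k N] (b : Module.Basis ι k B)
    {f g : TPlus k B →ₗ[k] N}
    (h : ∀ (n : ℕ) (hn : 0 < n) (i : Fin n → ι),
      f (word k B hn fun j => b (i j)) = g (word k B hn fun j => b (i j))) :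
    f = g := by
  apply DirectSum.linearMap_ext
  rintro ⟨n, hn⟩
  apply PiTensorProduct.ext
  exact Module.Basis.ext_multilinear (fun _ => b) fun i => h n hn i

/-- Algebra maps on `S(T(B)⁺)` are determined by their values on words in a basis of `B`. -/
theorem symT_algHom_ext {ι A : Type*} [CommRing A] [Algebra k A] (b : Module.Basis ι k B)
    {f g : SymT k B →ₐ[k] A}
    (h : ∀ (n : ℕ) (hn : 0 < n) (i : Fin n → ι),
      f (SymmetricAlgebra.ι k (TPlus k B) (word k B hn fun j => b (i j))) =
        g (SymmetricAlgebra.ι k (TPlus k B) (word k B hn fun j => b (i j)))) :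
    f = g :=
  SymmetricAlgebra.algHom_ext (tPlus_linearMap_ext k b h)

/-- Algebra maps on `S(S(B)⁺)` are determined by their values on the elements `{x₁,…,xₙ}`, with
`x₁,…,xₙ` in a basis of `B`. -/
theorem symS_algHom_ext {ι A : Type*} [CommRing A] [Algebra k A] (b : Module.Basis ι k B)
    {f g : SymS k B →ₐ[k] A}
    (h : ∀ (n : ℕ) (hn : 0 < n) (i : Fin n → ι),
      f (brace k hn fun j => b (i j)) = g (brace k hn fun j => b (i j))) :
    f = g := by
  have key : f.comp (symSymmetrize k B).rangeRestrict = g.comp (symSymmetrize k B).rangeRestrict :=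
    symT_algHom_ext k b h
  refine AlgHom.ext fun a => ?_
  obtain ⟨t, rfl⟩ := (symSymmetrize k B).rangeRestrict_surjective a
  exact AlgHom.congr_fun key t

/-- An algebra map on `S(T(B)⁺)` maps `S(S(B)⁺)` into a subalgebra as soon as it does so for the
elements `{x₁,…,xₙ}`, with `x₁,…,xₙ` in a basis of `B`. -/
theorem map_mem_of_brace_mem {ι A : Type*} [CommRing A] [Algebra k A] (b : Module.Basis ι k B)
    (f : SymT k B →ₐ[k] A) (S : Subalgebra k A)
    (h : ∀ (n : ℕ) (hn : 0 < n) (i : Fin n → ι), f (brace k hn fun j => b (i j)) ∈ S)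
    (a : SymS k B) : f a ∈ S := by
  obtain ⟨t, rfl⟩ := (symSymmetrize k B).rangeRestrict_surjective a
  induction t using SymmetricAlgebra.induction with
  | algebraMap r =>
    rw [AlgHom.commutes]
    exact (f.commutes r).symm ▸ S.algebraMap_mem r
  | ι v =>
    let F : TPlus k B →ₗ[k] A := f.toLinearMap ∘ₗ (symSymmetrize k B).toLinearMap ∘ₗ
      SymmetricAlgebra.ι k (TPlus k B)
    -- Membership in `S` becomes the vanishing of a linear map into the quotient, which can be
    -- tested on words in the basis.
    have key : (Subalgebra.toSubmodule S).mkQ ∘ₗ F = 0 := by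
      refine tPlus_linearMap_ext k b fun n hn i => ?_
      rw [LinearMap.comp_apply, LinearMap.zero_apply]
      exact (Submodule.Quotient.mk_eq_zero _).2 (h n hn i)
    exact (Submodule.Quotient.mk_eq_zero _).1 (LinearMap.congr_fun key v)
  | mul x y hx hy =>
    rw [map_mul, Subalgebra.coe_mul, map_mul]
    exact S.mul_mem hx hy
  | add x y hx hy =>
    rw [map_add, Subalgebra.coe_add, map_add]
    exact S.add_mem hx hy

end Words

/-! ### The renormalization bialgebra -/

section RenormBialgebra

variable (k : Type*) [Field k] {B : Type*} [CommRing B] [Bialgebra k B]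

/-- Contracted words again consist of group-like elements, so the coproduct formula can be applied a
second time. -/
theorem isGroupLikeElem_list_prod {l : List B} (h : ∀ b ∈ l, IsGroupLikeElem k b) :
    IsGroupLikeElem k l.prod := by
  induction l with
  | nil => exact IsGroupLikeElem.one
  | cons b l ih =>
    rw [List.prod_cons]
    exact (h b List.mem_cons_self).mul (ih fun c hc => h c (List.mem_cons_of_mem _ hc))

theorem list_prod_tmul {A A' α : Type*} [Ring A] [Algebra k A] [Ring A'] [Algebra k A']
    (f : α → A) (g : α → A') (l : List α) :
    (l.map fun a => f a ⊗ₜ[k] g a).prod = (l.map f).prod ⊗ₜ[k] (l.map g).prod := by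
  induction l with
  | nil => rfl
  | cons a l ih => simp [ih]

theorem freeComul_tprod {n : ℕ} (x : Fin n → B) (hx : ∀ i, IsGroupLikeElem k (x i)) :
    freeComul k B (TensorAlgebra.tprod k B n x) =
      TensorAlgebra.tprod k B n x ⊗ₜ TensorAlgebra.tprod k B n x := by
  have h : ∀ i, freeComul k B (TensorAlgebra.ι k (x i)) =
      TensorAlgebra.ι k (x i) ⊗ₜ TensorAlgebra.ι k (x i) := fun i => by
    rw [freeComul, TensorAlgebra.lift_ι_apply, LinearMap.comp_apply, (hx i).comul_eq_tmul_self,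
      TensorProduct.map_tmul]
  simp only [TensorAlgebra.tprod_apply, map_list_prod, List.map_ofFn, Function.comp_def, h]
  simp only [List.ofFn_eq_map, list_prod_tmul]

theorem renormComul_listWord {l : List B} (hl : l ≠ []) (h : ∀ b ∈ l, IsGroupLikeElem k b) :
    renormComul k B (listWord k l) =
      ∑ L ∈ segmentations l, (L.map (listWord k)).prod ⊗ₜ listWord k (L.map List.prod) := by
  have hn : 0 < l.length := List.length_pos_iff.2 hl
  rw [listWord, dif_pos hn, renormComul, SymmetricAlgebra.lift_ι_apply, word,
    LinearMap.compMultilinearMap_apply, DirectSum.toModule_lof, renormComulWord,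
    LinearMap.comp_apply, LinearMap.comp_apply, TensorPower.toTensorAlgebra_tprod,
    AlgHom.toLinearMap_apply, freeComul_tprod k l.get fun i => h _ (List.get_mem l i),
    LinearMap.sum_apply, ← sum_composition_eq_sum_segmentations l rfl]
  refine Finset.sum_congr rfl fun ρ _ => ?_
  rw [TensorProduct.map_tmul, LinearMap.comp_apply, LinearMap.comp_apply, component_tprod,
    restrict_tprod, contract_tprod, List.ofFn_get]

theorem renormCounit_listWord_singleton (b : B) :
    renormCounit k B (listWord k [b]) = Coalgebra.counit (R := k) b := by
  rw [listWord, dif_pos (by simp), renormCounit, SymmetricAlgebra.lift_ι_apply, word,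
    LinearMap.compMultilinearMap_apply, DirectSum.toModule_lof]
  simp only [↓reduceIte, List.length_singleton, PiTensorProduct.lift.tprod]
  simp

theorem renormCounit_listWord_of_length_ne_one {l : List B} (h : l.length ≠ 1) :
    renormCounit k B (listWord k l) = 0 := by
  rw [listWord]
  split_ifs with hl
  · rw [renormCounit, SymmetricAlgebra.lift_ι_apply, word,
      LinearMap.compMultilinearMap_apply, DirectSum.toModule_lof, if_neg h, LinearMap.zero_apply]
  · exact map_zero _

/-- If `B` has a basis of group-like elements, algebra maps on `S(T(B)⁺)` are determined by their
values on words of group-like elements. -/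
theorem symT_algHom_ext_of_isGroupLikeElem {ι A : Type*} [CommRing A] [Algebra k A]
    (b : Module.Basis ι k B) (hb : ∀ i, IsGroupLikeElem k (b i)) {f g : SymT k B →ₐ[k] A}
    (h : ∀ l : List B, l ≠ [] → (∀ c ∈ l, IsGroupLikeElem k c) →
      f (listWord k l) = g (listWord k l)) :
    f = g := by
  refine symT_algHom_ext k b fun n hn i => ?_
  rw [← listWord_ofFn k hn]
  refine h _ (by simpa using hn.ne') fun c hc => ?_
  obtain ⟨j, rfl⟩ := List.mem_ofFn.1 hc
  exact hb _

theorem renormComul_prod_listWord {L : List (List B)} (hL : ∀ s ∈ L, s ≠ [])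
    (h : ∀ s ∈ L, ∀ b ∈ s, IsGroupLikeElem k b) :
    renormComul k B (L.map (listWord k)).prod =
      ∑ K ∈ listChoices segmentations L,
        (K.map fun M => (M.map (listWord k)).prod).prod ⊗ₜ
          (K.map fun M => listWord k (M.map List.prod)).prod := by
  simp only [← list_prod_tmul]
  rw [← prod_map_sum_eq_sum_listChoices, map_list_prod, List.map_map]
  exact congrArg _ (List.map_congr_left fun s hs => renormComul_listWord k (hL s hs) (h s hs))

theorem renormComul_coassoc_listWord {l : List B} (hl : l ≠ [])
    (h : ∀ b ∈ l, IsGroupLikeElem k b) :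
    Algebra.TensorProduct.assoc k k k _ _ _
        (Algebra.TensorProduct.map (renormComul k B) (.id k (SymT k B))
          (renormComul k B (listWord k l))) =
      Algebra.TensorProduct.map (.id k (SymT k B)) (renormComul k B)
        (renormComul k B (listWord k l)) := by
  rw [renormComul_listWord k hl h]
  simp only [map_sum, Algebra.TensorProduct.map_tmul, AlgHom.id_apply]
  -- Both iterated coproducts are written with the same summand in `K`: the innermost segments as
  -- words, the words of their products, and the word of total products.
  have hleft : ∀ L ∈ segmentations l,
      Algebra.TensorProduct.assoc k k k (SymT k B) (SymT k B) (SymT k B)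
        (renormComul k B (L.map (listWord k)).prod ⊗ₜ listWord k (L.map List.prod)) =
      ∑ K ∈ listChoices segmentations L,
        (K.map fun M => (M.map (listWord k)).prod).prod ⊗ₜ
          ((K.map fun M => listWord k (M.map List.prod)).prod ⊗ₜ
            listWord k (K.map fun M => M.flatten.prod)) := by
    intro L hL
    obtain ⟨rfl, hL'⟩ := mem_segmentations.1 hL
    rw [renormComul_prod_listWord k hL' fun s hs b hb => h b (List.mem_flatten_of_mem hs hb),
      TensorProduct.sum_tmul, map_sum]
    refine Finset.sum_congr rfl fun K hK => ?_
    obtain ⟨rfl, -⟩ := mem_listChoices_segmentations.1 hK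
    rw [Algebra.TensorProduct.assoc_tmul, List.map_map]
    rfl
  have hright : ∀ L ∈ segmentations l,
      (L.map (listWord k)).prod ⊗ₜ[k] renormComul k B (listWord k (L.map List.prod)) =
      ∑ K ∈ segmentations L,
        (K.map fun M => (M.map (listWord k)).prod).prod ⊗ₜ
          ((K.map fun M => listWord k (M.map List.prod)).prod ⊗ₜ
            listWord k (K.map fun M => M.flatten.prod)) := by
    intro L hL
    have hne := ne_nil_of_mem_segmentations hl hL
    obtain ⟨rfl, hL'⟩ := mem_segmentations.1 hL
    rw [renormComul_listWord k (by simpa using hne), sum_segmentations_map,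
      TensorProduct.tmul_sum]
    · refine Finset.sum_congr rfl fun K hK => ?_
      obtain ⟨rfl, -⟩ := mem_segmentations.1 hK
      simp only [List.map_flatten, List.prod_flatten, List.map_map, Function.comp_def]
    · intro b hb
      obtain ⟨s, hs, rfl⟩ := List.mem_map.1 hb
      exact isGroupLikeElem_list_prod k fun c hc => h c (List.mem_flatten_of_mem hs hc)
  rw [Finset.sum_congr rfl hleft, Finset.sum_congr rfl hright, sum_segmentations_assoc]

theorem renormComul_rTensor_counit_listWord {l : List B} (hl : l ≠ [])
    (h : ∀ b ∈ l, IsGroupLikeElem k b) :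
    Algebra.TensorProduct.map (renormCounit k B) (.id k (SymT k B))
      (renormComul k B (listWord k l)) = 1 ⊗ₜ listWord k l := by
  rw [renormComul_listWord k hl h]
  simp only [map_sum, Algebra.TensorProduct.map_tmul, AlgHom.id_apply]
  -- Any other cutting has a segment of length different from one, which the counit kills.
  rw [Finset.sum_eq_single (l.map fun b => [b])]
  · rw [List.map_map, map_list_prod, List.map_map, List.map_map]
    congr 1
    · refine List.prod_eq_one fun x hx => ?_
      obtain ⟨b, hb, rfl⟩ := List.mem_map.1 hx
      exact (renormCounit_listWord_singleton k b).trans (h b hb).counit_eq_one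
    · simp [Function.comp_def]
  · intro L hL hne
    obtain ⟨rfl, hL'⟩ := mem_segmentations.1 hL
    obtain ⟨s, hs, h₁⟩ : ∃ s ∈ L, s.length ≠ 1 := by
      by_contra! hall
      refine hne ?_
      clear hne h hl hL hL'
      induction L with
      | nil => rfl
      | cons s L ih =>
        obtain ⟨b, rfl⟩ := List.length_eq_one_iff.1 (hall s List.mem_cons_self)
        simpa using ih fun s hs => hall s (List.mem_cons_of_mem _ hs)
    rw [map_list_prod, List.prod_eq_zero, TensorProduct.zero_tmul]
    rw [List.map_map]
    exact List.mem_map.2 ⟨s, hs, renormCounit_listWord_of_length_ne_one k h₁⟩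
  · intro hnot
    refine (hnot (mem_segmentations.2 ⟨?_, ?_⟩)).elim
    · rw [← List.flatMap_def, List.flatMap_singleton']
    · simp

theorem renormComul_lTensor_counit_listWord {l : List B} (hl : l ≠ [])
    (h : ∀ b ∈ l, IsGroupLikeElem k b) :
    Algebra.TensorProduct.map (.id k (SymT k B)) (renormCounit k B)
      (renormComul k B (listWord k l)) = listWord k l ⊗ₜ 1 := by
  rw [renormComul_listWord k hl h]
  simp only [map_sum, Algebra.TensorProduct.map_tmul, AlgHom.id_apply]
  -- With more than one segment, the contracted word has length greater than one and the counit
  -- kills it.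
  rw [Finset.sum_eq_single [l]]
  · rw [List.map_singleton, List.prod_singleton, List.map_singleton,
      renormCounit_listWord_singleton, (isGroupLikeElem_list_prod k h).counit_eq_one]
  · intro L hL hne
    obtain ⟨rfl, hL'⟩ := mem_segmentations.1 hL
    rw [renormCounit_listWord_of_length_ne_one, TensorProduct.tmul_zero]
    rw [List.length_map]
    intro h₁
    obtain ⟨s, rfl⟩ := List.length_eq_one_iff.1 h₁
    simp at hne
  · intro hnot
    exact (hnot (mem_segmentations.2 ⟨by simp, by simpa using hl⟩)).elim

/-- If `B` has a basis of group-like elements, `S(T(B)⁺)` is a bialgebra. -/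
theorem isBialgebraStructure_renorm {ι : Type*} (b : Module.Basis ι k B)
    (hb : ∀ i, IsGroupLikeElem k (b i)) :
    IsBialgebraStructure (renormComul k B) (renormCounit k B) where
  coassoc := symT_algHom_ext_of_isGroupLikeElem k b hb fun _ => renormComul_coassoc_listWord k
  rTensor_counit :=
    symT_algHom_ext_of_isGroupLikeElem k b hb fun _ => renormComul_rTensor_counit_listWord k
  lTensor_counit :=
    symT_algHom_ext_of_isGroupLikeElem k b hb fun _ => renormComul_lTensor_counit_listWord k

end RenormBialgebra

/-! ### Transport of bialgebra structures -/

section Transport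

variable {k : Type*} [Field k] {A A' : Type*} [CommRing A] [Algebra k A]
  [CommRing A'] [Algebra k A']

theorem tensorProduct_map_injective {C C' : Type*} [CommRing C] [Algebra k C] [CommRing C']
    [Algebra k C'] {f : A →ₐ[k] A'} {g : C →ₐ[k] C'} (hf : Function.Injective f)
    (hg : Function.Injective g) : Function.Injective (Algebra.TensorProduct.map f g) :=
  TensorProduct.map_injective_of_flat_flat f.toLinearMap g.toLinearMap hf hg

theorem tensorProduct_map_comp_apply {A₁ A₂ A₃ B₁ B₂ B₃ : Type*} [CommRing A₁] [Algebra k A₁]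
    [CommRing A₂] [Algebra k A₂] [CommRing A₃] [Algebra k A₃] [CommRing B₁] [Algebra k B₁]
    [CommRing B₂] [Algebra k B₂] [CommRing B₃] [Algebra k B₃] (f' : A₂ →ₐ[k] A₃) (f : A₁ →ₐ[k] A₂)
    (g' : B₂ →ₐ[k] B₃) (g : B₁ →ₐ[k] B₂) (x : A₁ ⊗[k] B₁) :
    Algebra.TensorProduct.map f' g' (Algebra.TensorProduct.map f g x) =
      Algebra.TensorProduct.map (f'.comp f) (g'.comp g) x := by
  rw [Algebra.TensorProduct.map_comp, AlgHom.comp_apply]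

variable {Δ : A →ₐ[k] A ⊗[k] A} {ε : A →ₐ[k] k} {Δ' : A' →ₐ[k] A' ⊗[k] A'} {ε' : A' →ₐ[k] k}
  {f : A →ₐ[k] A'}

/-- Naturality of the associator. This and the next three lemmas carry the sides of the axioms for
`Δ` to those for `Δ'` along `f`, ready to be pulled back when `f` is injective or pushed forward
when it is surjective. -/
theorem map_assoc_comul (hΔ : (Algebra.TensorProduct.map f f).comp Δ = Δ'.comp f) (a : A) :
    Algebra.TensorProduct.map f (Algebra.TensorProduct.map f f)
        (Algebra.TensorProduct.assoc k k k A A A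
          (Algebra.TensorProduct.map Δ (.id k A) (Δ a))) =
      Algebra.TensorProduct.assoc k k k A' A' A'
        (Algebra.TensorProduct.map Δ' (.id k A') (Δ' (f a))) := by
  have hassoc : ∀ t : (A ⊗[k] A) ⊗[k] A,
      Algebra.TensorProduct.map f (Algebra.TensorProduct.map f f)
          (Algebra.TensorProduct.assoc k k k A A A t) =
        Algebra.TensorProduct.assoc k k k A' A' A'
          (Algebra.TensorProduct.map (Algebra.TensorProduct.map f f) f t) := by
    have : (Algebra.TensorProduct.map f (Algebra.TensorProduct.map f f)).comp
          (Algebra.TensorProduct.assoc k k k A A A).toAlgHom =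
        (Algebra.TensorProduct.assoc k k k A' A' A').toAlgHom.comp
          (Algebra.TensorProduct.map (Algebra.TensorProduct.map f f) f) := by
      ext <;> simp [Algebra.TensorProduct.one_def]
    exact AlgHom.congr_fun this
  rw [hassoc, tensorProduct_map_comp_apply, ← AlgHom.comp_apply Δ' f, ← hΔ,
    AlgHom.comp_apply, tensorProduct_map_comp_apply, hΔ, AlgHom.comp_id, AlgHom.id_comp]

theorem map_map_comul (hΔ : (Algebra.TensorProduct.map f f).comp Δ = Δ'.comp f) (a : A) :
    Algebra.TensorProduct.map f (Algebra.TensorProduct.map f f)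
        (Algebra.TensorProduct.map (.id k A) Δ (Δ a)) =
      Algebra.TensorProduct.map (.id k A') Δ' (Δ' (f a)) := by
  rw [tensorProduct_map_comp_apply, ← AlgHom.comp_apply Δ' f, ← hΔ,
    AlgHom.comp_apply, tensorProduct_map_comp_apply, hΔ, AlgHom.comp_id, AlgHom.id_comp]

theorem map_rTensor_counit (hΔ : (Algebra.TensorProduct.map f f).comp Δ = Δ'.comp f)
    (hε : ε'.comp f = ε) (a : A) :
    Algebra.TensorProduct.map (.id k k) f (Algebra.TensorProduct.map ε (.id k A) (Δ a)) =
      Algebra.TensorProduct.map ε' (.id k A') (Δ' (f a)) := by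
  rw [← AlgHom.comp_apply Δ' f, ← hΔ, AlgHom.comp_apply, tensorProduct_map_comp_apply,
    tensorProduct_map_comp_apply, hε, AlgHom.comp_id, AlgHom.id_comp, AlgHom.id_comp]

theorem map_lTensor_counit (hΔ : (Algebra.TensorProduct.map f f).comp Δ = Δ'.comp f)
    (hε : ε'.comp f = ε) (a : A) :
    Algebra.TensorProduct.map f (.id k k) (Algebra.TensorProduct.map (.id k A) ε (Δ a)) =
      Algebra.TensorProduct.map (.id k A') ε' (Δ' (f a)) := by
  rw [← AlgHom.comp_apply Δ' f, ← hΔ, AlgHom.comp_apply, tensorProduct_map_comp_apply,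
    tensorProduct_map_comp_apply, hε, AlgHom.comp_id, AlgHom.id_comp, AlgHom.id_comp]

theorem IsBialgebraStructure.of_injective (h : IsBialgebraStructure Δ' ε')
    (hf : Function.Injective f) (hΔ : (Algebra.TensorProduct.map f f).comp Δ = Δ'.comp f)
    (hε : ε'.comp f = ε) : IsBialgebraStructure Δ ε where
  coassoc := AlgHom.ext fun a =>
    tensorProduct_map_injective hf (tensorProduct_map_injective hf hf) <|
      (map_assoc_comul hΔ a).trans <|
        (AlgHom.congr_fun h.coassoc (f a)).trans (map_map_comul hΔ a).symm
  rTensor_counit := AlgHom.ext fun a =>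
    tensorProduct_map_injective (f := .id k k) Function.injective_id hf <|
      (map_rTensor_counit hΔ hε a).trans <|
        (AlgHom.congr_fun h.rTensor_counit (f a)).trans (by simp)
  lTensor_counit := AlgHom.ext fun a =>
    tensorProduct_map_injective (g := .id k k) hf Function.injective_id <|
      (map_lTensor_counit hΔ hε a).trans <|
        (AlgHom.congr_fun h.lTensor_counit (f a)).trans (by simp)

theorem IsBialgebraStructure.of_surjective (h : IsBialgebraStructure Δ ε)
    (hf : Function.Surjective f) (hΔ : (Algebra.TensorProduct.map f f).comp Δ = Δ'.comp f)
    (hε : ε'.comp f = ε) : IsBialgebraStructure Δ' ε' where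
  coassoc := AlgHom.ext fun a' => by
    obtain ⟨a, rfl⟩ := hf a'
    exact (map_assoc_comul hΔ a).symm.trans <|
      (congrArg _ (AlgHom.congr_fun h.coassoc a)).trans (map_map_comul hΔ a)
  rTensor_counit := AlgHom.ext fun a' => by
    obtain ⟨a, rfl⟩ := hf a'
    exact (map_rTensor_counit hΔ hε a).symm.trans <|
      (congrArg _ (AlgHom.congr_fun h.rTensor_counit a)).trans (by simp)
  lTensor_counit := AlgHom.ext fun a' => by
    obtain ⟨a, rfl⟩ := hf a'
    exact (map_lTensor_counit hΔ hε a).symm.trans <|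
      (congrArg _ (AlgHom.congr_fun h.lTensor_counit a)).trans (by simp)

/-- A coproduct that maps a subalgebra `S` into `S ⊗ S` restricts to `S`. -/
theorem exists_comul_restrict (S : Subalgebra k A)
    (h : ∀ a : S, Δ a ∈ (Algebra.TensorProduct.map S.val S.val).range) :
    ∃ ΔS : S →ₐ[k] S ⊗[k] S, (Algebra.TensorProduct.map S.val S.val).comp ΔS = Δ.comp S.val := by
  have hinj : Function.Injective (Algebra.TensorProduct.map S.val S.val) :=
    tensorProduct_map_injective Subtype.val_injective Subtype.val_injective
  refine ⟨(AlgEquiv.ofInjective _ hinj).symm.toAlgHom.comp ((Δ.comp S.val).codRestrict _ h),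
    AlgHom.ext fun a => ?_⟩
  exact congrArg Subtype.val ((AlgEquiv.ofInjective _ hinj).apply_symm_apply ⟨Δ a, h a⟩)

end Transport

/-! ### The renormalization coproduct on `S(S(B)⁺)` -/

section Braces

variable (k : Type*) [Field k] {B : Type*} [CommRing B]

section

variable [Algebra k B] {α : Type*}

/-- The element `{x_a : a ∈ s}` of `S(S(B)⁺)`, for a finite set `s`, viewed in `S(T(B)⁺)`. -/
def setBrace (x : α → B) (s : Finset α) : SymT k B :=
  ∑ l ∈ orderings s, listWord k (l.map x)

theorem coe_brace_eq_setBrace {m : ℕ} (hm : 0 < m) {s : Finset α} (e : Fin m ≃ s) (x : α → B) :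
    (brace k hm (fun i => x (e i)) : SymT k B) = setBrace k x s := by
  rw [coe_brace, setBrace, ← sum_perm_eq_sum_orderings e]
  simp only [List.map_ofFn, Function.comp_def]

theorem setBrace_univ {n : ℕ} (hn : 0 < n) (x : Fin n → B) :
    setBrace k x Finset.univ = brace k hn x :=
  (coe_brace_eq_setBrace k hn (Equiv.subtypeUnivEquiv Finset.mem_univ).symm x).symm

theorem setBrace_mem (x : α → B) {s : Finset α} (hs : s.Nonempty) :
    setBrace k x s ∈ SymS k B := by
  rw [← coe_brace_eq_setBrace k (Finset.card_pos.2 hs) s.equivFin.symm]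
  exact Subtype.property _

end

variable [Bialgebra k B] {α : Type*} [DecidableEq α]

/-- As `B` is commutative, the product over a block does not depend on its ordering. The second
tensor factor is therefore constant, and the first splits by distributivity into one sum per block.
-/
theorem sum_listChoices_orderings_tmul (x : α → B) (P : List (Finset α)) :
    ∑ L ∈ listChoices orderings P,
        (L.map fun l => listWord k (l.map x) : List (SymT k B)).prod ⊗ₜ[k]
          (listWord k (L.map fun l => (l.map x).prod) : SymT k B) =
      (P.map (setBrace k x)).prod ⊗ₜ listWord k (P.map fun C => ∏ c ∈ C, x c) := by
  change _ = (P.map fun C => ∑ l ∈ orderings C, listWord k (l.map x)).prod ⊗ₜ[k] _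
  rw [prod_map_sum_eq_sum_listChoices, TensorProduct.sum_tmul]
  refine Finset.sum_congr rfl fun L hL => ?_
  obtain ⟨rfl, hL'⟩ := mem_listChoices_orderings.1 hL
  rw [List.map_map]
  congr 2
  exact List.map_congr_left fun l hl => (List.prod_toFinset x (hL' l hl)).symm

theorem renormComul_setBrace (x : α → B) (hx : ∀ a, IsGroupLikeElem k (x a)) {s : Finset α}
    (hs : s.Nonempty) :
    renormComul k B (setBrace k x s) =
      ∑ π : Finpartition s, (∏ C ∈ π.parts, setBrace k x C) ⊗ₜ
        setBrace k (fun C => ∏ c ∈ C, x c) π.parts := by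
  have h : ∀ l ∈ orderings s, renormComul k B (listWord k (l.map x)) =
      ∑ L ∈ segmentations l, (L.map fun l => listWord k (l.map x)).prod ⊗ₜ
        listWord k (L.map fun l => (l.map x).prod) := by
    intro l hl
    rw [renormComul_listWord, sum_segmentations_map]
    · simp only [List.map_map, Function.comp_def]
    · obtain ⟨a, ha⟩ := hs
      rw [Ne, List.map_eq_nil_iff]
      exact List.ne_nil_of_mem (((mem_orderings_iff.1 hl).2 a).2 ha)
    · intro b hb
      obtain ⟨a, -, rfl⟩ := List.mem_map.1 hb
      exact hx a
  rw [setBrace, map_sum, Finset.sum_congr rfl h, sum_orderings_segmentations]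
  refine Finset.sum_congr rfl fun π _ => ?_
  rw [setBrace, TensorProduct.tmul_sum]
  -- In the commutative algebra `S(T(B)⁺)` the product over the blocks does not depend on their
  -- order `P`; only the second factor does, and its sum over `P` is the brace of `π.parts`.
  refine Finset.sum_congr rfl fun P hP => ?_
  rw [sum_listChoices_orderings_tmul, Finset.prod, ← mem_orderings.1 hP, Multiset.map_coe,
    Multiset.prod_coe]

theorem renormComul_setBrace_mem (x : α → B) (hx : ∀ a, IsGroupLikeElem k (x a)) {s : Finset α}
    (hs : s.Nonempty) :
    renormComul k B (setBrace k x s) ∈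
      (Algebra.TensorProduct.map (SymS k B).val (SymS k B).val).range := by
  rw [renormComul_setBrace k x hx hs]
  refine sum_mem fun π _ => ?_
  have h₁ : ∏ C ∈ π.parts, setBrace k x C ∈ SymS k B :=
    prod_mem fun C hC => setBrace_mem k x (π.nonempty_of_mem_parts hC)
  have h₂ : setBrace k (fun C => ∏ c ∈ C, x c) π.parts ∈ SymS k B :=
    setBrace_mem k _ (π.parts_nonempty hs.ne_empty)
  exact ⟨⟨_, h₁⟩ ⊗ₜ ⟨_, h₂⟩, Algebra.TensorProduct.map_tmul _ _ _ _⟩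

end Braces

/-! ### The map to the Faà di Bruno bialgebra -/

section FaaDiBruno

variable (k : Type*) [Field k] {B : Type*} [CommRing B] [Bialgebra k B]

theorem faaComul_u {n : ℕ} (hn : 0 < n) :
    faaComul k (u k n) = ∑ π : Finpartition (Finset.univ : Finset (Fin n)),
      (∏ C ∈ π.parts, u k C.card) ⊗ₜ[k] u k π.parts.card := by
  -- `u` is indexed through `toPNat'`, which sends `0` to `1`; for the coercion of a positive number
  -- it gives that number back.
  obtain ⟨m, rfl⟩ : ∃ m : ℕ+, n = m := ⟨⟨n, hn⟩, rfl⟩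
  rw [faaComul, u, PNat.coe_toPNat']
  exact MvPolynomial.aeval_X _ _

theorem faaCounit_u {n : ℕ} (hn : 0 < n) : faaCounit k (u k n) = if n = 1 then 1 else 0 := by
  obtain ⟨m, rfl⟩ : ∃ m : ℕ+, n = m := ⟨⟨n, hn⟩, rfl⟩
  rw [faaCounit, u, PNat.coe_toPNat']
  simp only [PNat.coe_eq_one_iff]
  exact MvPolynomial.aeval_X _ _

variable (B) in
/-- The algebra map `S(T(B)⁺) → k[u₁,u₂,…]` with `(x₁,…,xₙ) ↦ ε(x₁)⋯ε(xₙ) uₙ / n!`. -/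
def symTToFaa : SymT k B →ₐ[k] FaaDiBruno k :=
  SymmetricAlgebra.lift (DirectSum.toModule k {n : ℕ // 0 < n} _ fun n =>
    PiTensorProduct.lift <| (LinearMap.toSpanSingleton k (FaaDiBruno k)
      ((n.1.factorial : k)⁻¹ • u k n.1)).compMultilinearMap <|
        (MultilinearMap.mkPiAlgebra k (Fin n.1) k).compLinearMap fun _ =>
          (Coalgebra.counit : B →ₗ[k] k))

theorem symTToFaa_listWord {l : List B} (hl : l ≠ []) (h : ∀ b ∈ l, IsGroupLikeElem k b) :
    symTToFaa k B (listWord k l) = (l.length.factorial : k)⁻¹ • u k l.length := by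
  rw [listWord, dif_pos (List.length_pos_iff.2 hl), symTToFaa, SymmetricAlgebra.lift_ι_apply, word,
    LinearMap.compMultilinearMap_apply, DirectSum.toModule_lof]
  have : ∏ i, Coalgebra.counit (R := k) (l.get i) = 1 :=
    Finset.prod_eq_one fun i _ => (h _ (List.get_mem l i)).counit_eq_one
  simp only [PiTensorProduct.lift.tprod, LinearMap.compMultilinearMap_apply,
    MultilinearMap.compLinearMap_apply, MultilinearMap.mkPiAlgebra_apply]
  rw [this, LinearMap.toSpanSingleton_apply, one_smul]

theorem card_orderings {α : Type*} (s : Finset α) : (orderings s).card = s.card.factorial := by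
  have := sum_perm_eq_sum_orderings s.equivFin.symm fun _ => 1
  simpa [Fintype.card_perm] using this.symm

/-- The `n!` orderings contribute equally and cancel the factor `1 / n!`, which is where
characteristic zero enters. -/
theorem symTToFaa_setBrace [CharZero k] {α : Type*} (x : α → B)
    (hx : ∀ a, IsGroupLikeElem k (x a)) {s : Finset α} (hs : s.Nonempty) :
    symTToFaa k B (setBrace k x s) = u k s.card := by
  have h : ∀ l ∈ orderings s, symTToFaa k B (listWord k (l.map x)) =
      (s.card.factorial : k)⁻¹ • u k s.card := by
    intro l hl
    have hlen : (l.map x).length = s.card := by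
      rw [List.length_map, ← Multiset.coe_card, mem_orderings.1 hl, Finset.card_val]
    rw [symTToFaa_listWord, hlen]
    · rw [← List.length_pos_iff, hlen]
      exact hs.card_pos
    · intro b hb
      obtain ⟨a, -, rfl⟩ := List.mem_map.1 hb
      exact hx a
  rw [setBrace, map_sum, Finset.sum_congr rfl h, Finset.sum_const, card_orderings,
    ← Nat.cast_smul_eq_nsmul k, smul_inv_smul₀ (Nat.cast_ne_zero.2 s.card.factorial_ne_zero)]

variable (B) in
/-- The algebra map `S(S(B)⁺) → k[u₁,u₂,…]` with `{x₁,…,xₙ} ↦ ε(x₁)⋯ε(xₙ) uₙ`. -/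
def symSToFaa : SymS k B →ₐ[k] FaaDiBruno k := (symTToFaa k B).comp (SymS k B).val

theorem symSToFaa_brace [CharZero k] {n : ℕ} (hn : 0 < n) (x : Fin n → B)
    (hx : ∀ i, IsGroupLikeElem k (x i)) : symSToFaa k B (brace k hn x) = u k n := by
  have : NeZero n := ⟨hn.ne'⟩
  rw [symSToFaa, AlgHom.comp_apply, Subalgebra.coe_val, ← setBrace_univ,
    symTToFaa_setBrace k x hx Finset.univ_nonempty, Finset.card_univ, Fintype.card_fin]

theorem symSToFaa_surjective [CharZero k] : Function.Surjective (symSToFaa k B) := by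
  rw [← AlgHom.range_eq_top, eq_top_iff]
  intro p _
  let e := FaaDiBruno.toMvPolynomial k
  obtain ⟨q, rfl⟩ := e.symm.surjective p
  induction q using MvPolynomial.induction_on with
  | C r => exact (e.symm.commutes r).symm ▸ Subalgebra.algebraMap_mem _ r
  | add p q hp hq => exact (map_add e.symm p q).symm ▸ add_mem (hp trivial) (hq trivial)
  | mul_X p n hp =>
    -- The unit of `B` is group-like, so the brace of `n` copies of it is a preimage of `u_n`.
    refine (map_mul e.symm p _).symm ▸ mul_mem (hp trivial) ⟨brace k n.pos fun _ => 1, ?_⟩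
    refine (symSToFaa_brace k n.pos _ fun _ => IsGroupLikeElem.one).trans ?_
    rw [u, PNat.coe_toPNat']

theorem renormCounit_brace {n : ℕ} (hn : 0 < n) (x : Fin n → B)
    (hx : ∀ i, IsGroupLikeElem k (x i)) :
    renormCounit k B (brace k hn x) = if n = 1 then 1 else 0 := by
  rw [coe_brace, map_sum]
  split_ifs with h
  · subst h
    rw [Fintype.sum_unique]
    exact (renormCounit_listWord_singleton k _).trans (hx _).counit_eq_one
  · exact Finset.sum_eq_zero fun σ _ => renormCounit_listWord_of_length_ne_one k (by simpa using h)

end FaaDiBruno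

/-! ### Compatibility of the map with coproducts and counits, given a basis of group-like elements.
-/

section GroupLikeBasis

theorem exists_comul_symS (k : Type*) [Field k] {B : Type*} [CommRing B] [Bialgebra k B]
    {ι : Type*} (b : Module.Basis ι k B) (hb : ∀ i, IsGroupLikeElem k (b i)) :
    ∃ Δ : SymS k B →ₐ[k] SymS k B ⊗[k] SymS k B,
    (Algebra.TensorProduct.map (SymS k B).val (SymS k B).val).comp Δ =
      (renormComul k B).comp (SymS k B).val := by
  refine exists_comul_restrict _ (map_mem_of_brace_mem k b _ _ fun n hn i => ?_)
  have : NeZero n := ⟨hn.ne'⟩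
  rw [← setBrace_univ]
  exact renormComul_setBrace_mem k _ (fun j => hb (i j)) Finset.univ_nonempty

theorem map_symSToFaa_comul (k : Type*) [Field k] [CharZero k] {B : Type*} [CommRing B]
    [Bialgebra k B] {ι : Type*} (b : Module.Basis ι k B) (hb : ∀ i, IsGroupLikeElem k (b i))
    {Δ : SymS k B →ₐ[k] SymS k B ⊗[k] SymS k B}
    (hΔ : (Algebra.TensorProduct.map (SymS k B).val (SymS k B).val).comp Δ =
      (renormComul k B).comp (SymS k B).val) :
    (Algebra.TensorProduct.map (symSToFaa k B) (symSToFaa k B)).comp Δ =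
      (faaComul k).comp (symSToFaa k B) := by
  refine symS_algHom_ext k b fun n hn i => ?_
  have : NeZero n := ⟨hn.ne'⟩
  have hx : ∀ j, IsGroupLikeElem k (b (i j)) := fun j => hb (i j)
  rw [AlgHom.comp_apply, AlgHom.comp_apply, symSToFaa_brace k hn _ hx, faaComul_u k hn, symSToFaa,
    ← tensorProduct_map_comp_apply, ← AlgHom.comp_apply _ Δ, hΔ, AlgHom.comp_apply,
    Subalgebra.coe_val, ← setBrace_univ, renormComul_setBrace k _ hx Finset.univ_nonempty, map_sum]
  refine Finset.sum_congr rfl fun π _ => ?_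
  rw [Algebra.TensorProduct.map_tmul, map_prod, symTToFaa_setBrace k _ _
    (π.parts_nonempty Finset.univ_nonempty.ne_empty)]
  · exact congrArg (· ⊗ₜ[k] _) (Finset.prod_congr rfl fun C hC =>
      symTToFaa_setBrace k _ hx (π.nonempty_of_mem_parts hC))
  -- Block products are group-like, so the brace of the blocks of `π` also goes to a single
  -- generator.
  · exact fun C => Finset.prod_induction _ _ (fun _ _ => IsGroupLikeElem.mul) IsGroupLikeElem.one
      fun j _ => hx j

theorem faaCounit_comp_symSToFaa (k : Type*) [Field k] [CharZero k] {B : Type*} [CommRing B]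
    [Bialgebra k B] {ι : Type*} (b : Module.Basis ι k B) (hb : ∀ i, IsGroupLikeElem k (b i)) :
    (faaCounit k).comp (symSToFaa k B) = (renormCounit k B).comp (SymS k B).val := by
  refine symS_algHom_ext k b fun n hn i => ?_
  have hx : ∀ j, IsGroupLikeElem k (b (i j)) := fun j => hb (i j)
  rw [AlgHom.comp_apply, AlgHom.comp_apply, symSToFaa_brace k hn _ hx, faaCounit_u k hn,
    Subalgebra.coe_val, renormCounit_brace k hn _ hx]

end GroupLikeBasis

end Renormalization

end

open Renormalization

theorem mainTheorem3 (k : Type*) [Field k] [CharZero k] (G : Type*) [CommGroup G] :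
    ∃ (Δ : SymS k (MonoidAlgebra k G) →ₐ[k]
          SymS k (MonoidAlgebra k G) ⊗[k] SymS k (MonoidAlgebra k G))
      (hS : IsBialgebraStructure Δ
        ((renormCounit k (MonoidAlgebra k G)).comp (SymS k (MonoidAlgebra k G)).val))
      (hF : IsBialgebraStructure (faaComul k) (faaCounit k)),
      (Algebra.TensorProduct.map (SymS k (MonoidAlgebra k G)).val
          (SymS k (MonoidAlgebra k G)).val).comp Δ =
        (renormComul k (MonoidAlgebra k G)).comp (SymS k (MonoidAlgebra k G)).val ∧
      letI : Bialgebra k (SymS k (MonoidAlgebra k G)) := hS.toBialgebra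
      letI : Bialgebra k (FaaDiBruno k) := hF.toBialgebra
      ∃ φ : SymS k (MonoidAlgebra k G) →ₐc[k] FaaDiBruno k,
        (φ 1 = 1 ∧
          ∀ (n : ℕ) (hn : 0 < n) (x : Fin n → G),
            φ (brace k hn fun i => MonoidAlgebra.of k G (x i)) = u k n) ∧
        Function.Surjective φ ∧
        ∀ ψ : SymS k (MonoidAlgebra k G) →ₐ[k] FaaDiBruno k,
          (∀ (n : ℕ) (hn : 0 < n) (x : Fin n → G),
            ψ (brace k hn fun i => MonoidAlgebra.of k G (x i)) = u k n) →
          ψ = (φ : SymS k (MonoidAlgebra k G) →ₐ[k] FaaDiBruno k) := by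
  let b : Module.Basis G k (MonoidAlgebra k G) := MonoidAlgebra.basis G k
  have hof : ∀ g, MonoidAlgebra.of k G g = b g := fun g => (MonoidAlgebra.basis_apply ..).symm
  have hb : ∀ g, IsGroupLikeElem k (b g) := fun g => hof g ▸ MonoidAlgebra.isGroupLikeElem_of g
  obtain ⟨Δ, hΔ⟩ := exists_comul_symS k b hb
  have hS := (isBialgebraStructure_renorm k b hb).of_injective
    (f := (SymS k (MonoidAlgebra k G)).val) Subtype.val_injective hΔ rfl
  have hφΔ := map_symSToFaa_comul k b hb hΔ
  have hφε := faaCounit_comp_symSToFaa k b hb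
  -- The Faà di Bruno axioms need no computation of their own: they are images of those on
  -- `S(S(B)⁺)`.
  have hF := hS.of_surjective (symSToFaa_surjective k) hφΔ hφε
  have hφ : ∀ (n : ℕ) (hn : 0 < n) (x : Fin n → G),
      symSToFaa k (MonoidAlgebra k G) (brace k hn fun i => MonoidAlgebra.of k G (x i)) = u k n :=
    fun n hn x => symSToFaa_brace k hn _ fun i => MonoidAlgebra.isGroupLikeElem_of (x i)
  refine ⟨Δ, hS, hF, hΔ, ?_⟩
  let : Bialgebra k (SymS k (MonoidAlgebra k G)) := hS.toBialgebra
  let : Bialgebra k (FaaDiBruno k) := hF.toBialgebra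
  refine ⟨BialgHom.ofAlgHom (symSToFaa k (MonoidAlgebra k G)) hφε hφΔ, ⟨map_one _, hφ⟩,
    symSToFaa_surjective k, fun ψ hψ => symS_algHom_ext k b fun n hn i => ?_⟩
  simp only [← hof]
  exact (hψ n hn i).trans (hφ n hn i).symm
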